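/- Let $\lambda$ be an infinite regular cardinal, and let $E^{\lambda^+}_\lambda:=\{\alpha<\lambda^+\mid \mathrm{cf}(\alpha)=\lambda\}$. Suppose that the principle $\clubsuit_{AD}(\{E^{\lambda^+}_\lambda\},\lambda,1)$ holds, that is, there is a sequence $\langle\mathcal A_\alpha\mid\alpha\in E^{\lambda^+}_\lambda\rangle$ such that: \begin{enumerate} \item for every $\alpha\in E^{\lambda^+}_\lambda$, $\mathcal A_\alpha$ is a family of pairwise disjoint cofinal subsets of $\alpha$ with $|\mathcal A_\alpha|=\lambda$; \item for any two distinct $A,A'\in\bigcup_{\alpha\in E^{\lambda^+}_\lambda}\mathcal A_\alpha$, $\sup(A\cap A')<\sup(A)$; \item for every family $\mathcal B$ of at most one subset of $\lambda^+$, whose members have cardinality $\lambda^+$, the set $\{\alpha\in E^{\lambda^+}_\lambda\mid \sup(A\cap B)=\alpha\text{ for all }A\in\mathcal A_\alpha\text{ and }B\in\mathcal B\}$ is stationary in $\lambda^+$. \end{enumerate} Then there is a topological space $\mathbb X$ of cardinality $\lambda^+$ such that: \begin{itemize} \item $\mathbb X$ is collectionwise normal: for every family $\langle K_i\mid i\in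 I\rangle$ of closed sets that is discrete (every point has an open neighborhood $U$ such that $U\cap K_i\ne\emptyset$ for at most one $i\in I$), there are pairwise disjoint open sets $\langle U_i\mid i\in I\rangle$ with $K_i\subseteq U_i$ for all $i\in I$; \item $\mathbb X$ is a Dowker space: it is Hausdorff and normal, and $\mathbb X\times[0,1]$ is not normal; \item the hereditary density of $\mathbb X$, i.e. the least infinite cardinal $\mu$ such that every subspace of $\mathbb X$ has a dense subset of cardinality at most $\mu$, equals $\lambda$; \item the Lindelöf degree of $\mathbb X$, i.e. the least infinite cardinal $\mu$ such that every open cover of $\mathbb X$ has a subcover of cardinality at most $\mu$, equals $\lambda^+$. \end{itemize} -/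

import Mathlib

open Set
open scoped Cardinal

universe u

/-- `E^κ_μ`: the ordinals below `κ` of cofinality `μ`. -/
def cofLevel (κ μ : Cardinal.{u}) : Set Ordinal.{u} :=
  {β | β < κ.ord ∧ β.cof = μ}

/-- `S` is a stationary subset of (the ordinal) `κ`. -/
def IsStationaryIn (κ : Cardinal.{u}) (S : Set Ordinal.{u}) : Prop :=
  S ⊆ Iio κ.ord ∧ IsStationary {α : Iio κ.ord | (α : Ordinal.{u}) ∈ S}

/-- `A` is a cofinal subset of the ordinal `α`. -/
def IsCofinalSubset (A : Set Ordinal.{u}) (α : Ordinal.{u}) : Prop :=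
  A ⊆ Iio α ∧ ∀ β < α, ∃ γ ∈ A, β ≤ γ

/-- `⟨𝒜 α | α ∈ S⟩` is an AD-multi-ladder system, where `S` is a set of ordinals below `κ`
(only the values of `𝒜` on `S` matter): for every nonzero limit `α ∈ S`, `𝒜 α` is a nonempty
family of pairwise disjoint cofinal subsets of `α`, and any two distinct members `A`, `A'` of
`⋃ α ∈ S, 𝒜 α` satisfy `sup (A ∩ A') < sup A`. -/
def IsADMultiLadderSystem (κ : Cardinal.{u}) (S : Set Ordinal.{u})
    (𝒜 : Ordinal.{u} → Set (Set Ordinal.{u})) : Prop :=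
  (∀ α ∈ S, α < κ.ord → Order.IsSuccLimit α →
    (𝒜 α).Nonempty ∧ (∀ A ∈ 𝒜 α, IsCofinalSubset A α) ∧
    (∀ A ∈ 𝒜 α, ∀ A' ∈ 𝒜 α, A ≠ A' → Disjoint A A')) ∧
  (∀ A ∈ ⋃ α ∈ S, 𝒜 α, ∀ A' ∈ ⋃ α ∈ S, 𝒜 α, A ≠ A' → sSup (A ∩ A') < sSup A)

/-- `[κ]^κ`: the subsets of (the ordinal) `κ` of cardinality `κ`. -/
def fullSubsets (κ : Cardinal.{u}) : Set (Set Ordinal.{u}) :=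
  {B | B ⊆ Iio κ.ord ∧ #B = Cardinal.lift.{u + 1} κ}

/-- The principle `♣_AD(𝒮, μ, <θ)` for a family `𝒮` of stationary subsets of `κ`. -/
def ClubADLT (κ : Cardinal.{u}) (𝒮 : Set (Set Ordinal.{u})) (μ θ : Cardinal.{u}) : Prop :=
  ∃ 𝒜 : Ordinal.{u} → Set (Set Ordinal.{u}),
    IsADMultiLadderSystem κ (⋃₀ 𝒮) 𝒜 ∧
    (∀ α ∈ ⋃₀ 𝒮, #(𝒜 α) = Cardinal.lift.{u + 1} μ) ∧
    ∀ ℬ ⊆ fullSubsets κ, #ℬ < Cardinal.lift.{u + 1} θ → ∀ S ∈ 𝒮,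
      IsStationaryIn κ {α ∈ S | ∀ A ∈ 𝒜 α, ∀ B ∈ ℬ, sSup (A ∩ B) = α}

/-- The principle `♣_AD(𝒮, μ, θ)`, i.e. `♣_AD(𝒮, μ, <(θ+1))`: at most `θ` many sets are
guessed simultaneously. -/
def ClubAD (κ : Cardinal.{u}) (𝒮 : Set (Set Ordinal.{u})) (μ θ : Cardinal.{u}) : Prop :=
  ClubADLT κ 𝒮 μ (Order.succ θ)

section Spaces

variable (X : Type u) [TopologicalSpace X]

/-- A family of sets is discrete if every point has an open neighborhood that meets at most
one member (counted by indices). -/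
def IsDiscreteFamily {X : Type u} [TopologicalSpace X] {ι : Type u} (K : ι → Set X) : Prop :=
  ∀ x : X, ∃ U : Set X, IsOpen U ∧ x ∈ U ∧ {i | (U ∩ K i).Nonempty}.Subsingleton

/-- Collectionwise normality. Index types in the universe of `X` suffice: the nonempty members of
a discrete family are pairwise disjoint, so they are indexed by at most `#X` indices, and empty
members are separated by empty sets. -/
def IsCollectionwiseNormal : Prop :=
  ∀ (ι : Type u) (K : ι → Set X), (∀ i, IsClosed (K i)) → IsDiscreteFamily K →
    ∃ U : ι → Set X, (∀ i, IsOpen (U i)) ∧ (∀ i, K i ⊆ U i) ∧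
      ∀ i j, i ≠ j → Disjoint (U i) (U j)

/-- A Dowker space: a normal Hausdorff space whose product with the closed unit interval is not
normal. -/
def IsDowker : Prop :=
  T2Space X ∧ NormalSpace X ∧ ¬ NormalSpace (X × unitInterval)

/-- The hereditary density number: the least infinite cardinal `μ` such that each subspace has a
dense subset of cardinality at most `μ`. -/
noncomputable def hereditaryDensity : Cardinal.{u} :=
  sInf {μ | ℵ₀ ≤ μ ∧ ∀ Y : Set X, ∃ D : Set Y, Dense D ∧ #D ≤ μ}

/-- The Lindelöf degree: the least infinite cardinal `μ` such that every open cover has a subcover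
of cardinality at most `μ`. -/
noncomputable def lindelofDegree : Cardinal.{u} :=
  sInf {μ | ℵ₀ ≤ μ ∧ ∀ 𝒰 : Set (Set X), (∀ U ∈ 𝒰, IsOpen U) → ⋃₀ 𝒰 = univ →
    ∃ 𝒱 ⊆ 𝒰, #𝒱 ≤ μ ∧ ⋃₀ 𝒱 = univ}

end Spaces

/-! Points are triples: a height below `λ⁺`, a column below `λ` and a level in `ℕ`. An open set
containing `x` must contain tails of two kinds of sets. If the height of `x` lies in `E`, these are
the copies of the ladder belonging to `x` in every column and at every level up to that of `x`. At
each lower height `δ`, it is the `λ`-sequence of points at the level of `x` in the columns `code i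
(fn β i) p`, where `β` and `p` are the height and column of `x`.

Unbounded closed sets are large. Such a set is unbounded at some fixed column and level `m`.
Guessing puts all points of level at least `m` at a single height `α` into the closure, and the
second kind of convergence carries this to every higher point of level at least `m`
(`exists_height_forall_mem`). Hence two disjoint closed sets are never both unbounded, every
subspace has a dense subset of size at most `λ`, and open expansions of the closed sets of points of
level at least `n` have a common point, which makes the product with the interval non-normal.

Bounded parts are tame. Only `λ` points lie below a given height, and each has fewer than `λ`
predecessors in an enumeration. Regularity of `λ`, almost disjointness of the ladders and eventual
difference of the functions `fn β` therefore allow the converging sets to be trimmed until disjoint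
(`exists_disjoint_surrounds`). Closing off along the trimmed sets separates bounded discrete
families (`exists_separation_of_bounded`). In any discrete family all members but one are bounded by
a common height, so collectionwise normality follows. -/

/-! ### Initial ordinals and regularity. -/

/-- The well-ordered set of ordinals below the initial ordinal of `μ`, in the universe of `μ`. -/
abbrev Initial (μ : Cardinal.{u}) : Type u := μ.ord.ToType

theorem Initial.mk_eq (μ : Cardinal.{u}) : #(Initial μ) = μ := Cardinal.mk_ord_toType μ

theorem Initial.exists_forall_lt {μ : Cardinal.{u}} (hμ : μ.IsRegular) (S : Set (Initial μ))
    (hS : #S < μ) : ∃ b, ∀ a ∈ S, a < b := by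
  by_contra! hb
  have h1 : IsCofinal S := fun b => by
    obtain ⟨a, ha, hab⟩ := hb b
    exact ⟨a, ha, hab⟩
  have h2 := Order.cof_le h1
  rw [Ordinal.cof_toType, hμ.cof_ord] at h2
  exact absurd hS (not_lt.2 h2)

theorem Initial.exists_forall_lt_image {μ : Cardinal.{u}} (hμ : μ.IsRegular) {T : Type u}
    (S : Set T) (hS : #S < μ) (f : T → Initial μ) : ∃ b, ∀ a ∈ S, f a < b := by
  obtain ⟨b, hb⟩ := Initial.exists_forall_lt hμ (f '' S) (Cardinal.mk_image_le.trans_lt hS)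
  exact ⟨b, fun a ha => hb _ ⟨a, ha, rfl⟩⟩

theorem Initial.nonempty {μ : Cardinal.{u}} (hμ : μ.IsRegular) : Nonempty (Initial μ) := by
  rw [← Cardinal.mk_ne_zero_iff, Initial.mk_eq]
  exact hμ.ne_zero

theorem Initial.exists_gt {μ : Cardinal.{u}} (hμ : μ.IsRegular) (a : Initial μ) : ∃ b, a < b := by
  obtain ⟨b, hb⟩ := Initial.exists_forall_lt hμ {a} (by simpa using hμ.nat_lt 1)
  exact ⟨b, hb a rfl⟩

theorem Initial.mk_Iio_lt {μ : Cardinal.{u}} (a : Initial μ) : #(Iio a) < μ := by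
  simpa using Cardinal.mk_Iio_lt a (by simp)

theorem Initial.mk_Iic_lt {μ : Cardinal.{u}} (hμ : μ.IsRegular) (a : Initial μ) :
    #(Iic a) < μ := by
  obtain ⟨b, hb⟩ := Initial.exists_gt hμ a
  exact (Cardinal.mk_le_mk_of_subset fun c hc => lt_of_le_of_lt hc hb).trans_lt
    (Initial.mk_Iio_lt b)

/-- A set that a function injects into a proper initial segment is small. -/
theorem Initial.mk_lt_of_injOn {μ : Cardinal.{u}} {T : Type u} {S : Set T}
    {f : T → Initial μ} (hf : InjOn f S) {J : Set (Initial μ)} (hJ : #J < μ)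
    (hS : ∀ a ∈ S, f a ∈ J) : #S < μ :=
  lt_of_le_of_lt (Cardinal.mk_le_of_injective
    (f := fun a : S => (⟨f a, hS a a.2⟩ : J))
    fun a b hab => Subtype.ext (hf a.2 b.2 (congrArg Subtype.val hab))) hJ

theorem Initial.exists_injOn {μ : Cardinal.{u}} {T : Type u} (hμ : μ ≠ 0) {S : Set T}
    (hS : #S ≤ μ) : ∃ f : T → Initial μ, InjOn f S := by
  classical
  rw [← Initial.mk_eq μ] at hS
  obtain ⟨e⟩ := hS
  have : Nonempty (Initial μ) := by
    rw [← Cardinal.mk_ne_zero_iff, Initial.mk_eq]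
    exact hμ
  refine ⟨fun a => if h : a ∈ S then e ⟨a, h⟩ else Classical.arbitrary _, ?_⟩
  intro a ha b hb hab
  simpa [ha, hb] using hab

/-- Every family of fewer than `μ⁺` functions has an eventual strict upper bound, so there is
a strictly increasing sequence of length `μ⁺` modulo bounded sets. -/
theorem Initial.exists_eventually_increasing {μ : Cardinal.{u}} (hμ : μ.IsRegular) :
    ∃ fn : Initial (Order.succ μ) → Initial μ → Initial μ,
      ∀ β β', β < β' → ∃ i₀, ∀ i, i₀ ≤ i → fn β i < fn β' i := by
  classical
  have hidx : ∀ β : Initial (Order.succ μ), ∃ r : Initial (Order.succ μ) → Initial μ,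
      InjOn r (Iio β) := fun β => Initial.exists_injOn hμ.ne_zero
        (Order.lt_succ_iff.1 (Initial.mk_Iio_lt β))
  choose r hr using hidx
  -- At coordinate `i` only the `γ` with `r β γ ≤ i` are dominated. There are fewer than `μ` of
  -- these, and each `γ` is dominated from `r β γ` on.
  have hstep : ∀ (β : Initial (Order.succ μ))
      (g : ∀ γ, γ < β → Initial μ → Initial μ) (i : Initial μ),
      ∃ b, ∀ γ (h : γ < β), r β γ ≤ i → g γ h i < b := by
    intro β g i
    obtain ⟨b, hb⟩ := Initial.exists_forall_lt_image hμ {γ | γ < β ∧ r β γ ≤ i}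
      (Initial.mk_lt_of_injOn (f := r β) ((hr β).mono fun _ h => h.1)
        (Initial.mk_Iic_lt hμ i) fun _ h => h.2)
      (fun γ => if h : γ < β then g γ h i else i)
    refine ⟨b, fun γ h hi => ?_⟩
    simpa [h] using hb γ ⟨h, hi⟩
  choose up hup using hstep
  let fn : Initial (Order.succ μ) → Initial μ → Initial μ :=
    (wellFounded_lt (α := Initial (Order.succ μ))).fix fun β g => up β g
  have hfn : ∀ β, fn β = up β fun γ _ => fn γ := fun β =>
    WellFounded.fix_eq _ (fun β g => up β g) β
  refine ⟨fn, fun β β' h => ⟨r β' β, fun i hi => ?_⟩⟩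
  rw [hfn β']
  exact hup β' (fun γ _ => fn γ) i β h hi

/-! ### The space of a ladder system. -/

/-- The combinatorial data from which the space is built. -/
structure LadderSystem (lam : Cardinal.{u}) where
  /-- The set of limits at which there are ladders. -/
  E : Set (Initial (Order.succ lam))
  /-- The ladders. -/
  ladder : Initial (Order.succ lam) → Initial lam → ℕ → Set (Initial (Order.succ lam))
  /-- An increasing sequence of functions modulo bounded sets. -/
  fn : Initial (Order.succ lam) → Initial lam → Initial lam
  /-- A coding of triples. -/
  code : Initial lam → Initial lam → Initial lam → Initial lam
  isRegular : lam.IsRegular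
  exists_bound : ∀ α ∈ E, ∀ S : Set (Initial (Order.succ lam)), (∀ s ∈ S, s < α) → #S < lam →
    ∃ γ < α, ∀ s ∈ S, s < γ
  lt_of_mem_ladder : ∀ α ∈ E, ∀ p n, ∀ a ∈ ladder α p n, a < α
  ladder_inter : ∀ α ∈ E, ∀ α' ∈ E, ∀ p n p' n', (α, p, n) ≠ (α', p', n') →
    ∃ γ < α, ∀ a ∈ ladder α p n, a ∈ ladder α' p' n' → a < γ
  guess : ∀ Y : Set (Initial (Order.succ lam)), (∀ b, ∃ a ∈ Y, b ≤ a) →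
    ∃ α ∈ E, ∀ p n, ∀ γ < α, ∃ a ∈ ladder α p n, a ∈ Y ∧ γ ≤ a
  fn_lt : ∀ β β', β < β' → ∃ i₀, ∀ i, i₀ ≤ i → fn β i < fn β' i
  code_inj : ∀ i k p i' k' p', code i k p = code i' k' p' → i = i' ∧ k = k' ∧ p = p'

namespace LadderSystem

variable {lam : Cardinal.{u}} (D : LadderSystem lam)

/-- The points of the space of a ladder system. -/
@[ext]
structure Point (D : LadderSystem lam) : Type u where
  /-- The height of the point. -/
  base : Initial (Order.succ lam)
  /-- The position of the point at its height. -/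
  col : Initial lam
  /-- The level of the point. -/
  lvl : ℕ

variable {D}

/-- The set `U` contains tails of all the sets that converge to `x`. -/
def Surrounds (x : Point D) (U : Set (Point D)) : Prop :=
  (x.base ∈ D.E → ∀ q m, m ≤ x.lvl → ∃ γ < x.base, ∀ a ∈ D.ladder x.base x.col x.lvl,
    γ ≤ a → (⟨a, q, m⟩ : Point D) ∈ U) ∧
  ∀ δ < x.base, ∃ i₀, ∀ i, i₀ ≤ i →
    (⟨δ, D.code i (D.fn x.base i) x.col, x.lvl⟩ : Point D) ∈ U

theorem Surrounds.mono {x : Point D} {U V : Set (Point D)} (h : Surrounds x U) (hUV : U ⊆ V) :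
    Surrounds x V := by
  refine ⟨fun hE q m hm => ?_, fun δ hδ => ?_⟩
  · obtain ⟨γ, hγ, h'⟩ := h.1 hE q m hm
    exact ⟨γ, hγ, fun a ha hle => hUV (h' a ha hle)⟩
  · obtain ⟨i₀, h'⟩ := h.2 δ hδ
    exact ⟨i₀, fun i hi => hUV (h' i hi)⟩

theorem Surrounds.inter {x : Point D} {U V : Set (Point D)} (h : Surrounds x U)
    (h' : Surrounds x V) : Surrounds x (U ∩ V) := by
  refine ⟨fun hE q m hm => ?_, fun δ hδ => ?_⟩
  · obtain ⟨γ, hγ, h₁⟩ := h.1 hE q m hm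
    obtain ⟨γ', hγ', h₂⟩ := h'.1 hE q m hm
    exact ⟨max γ γ', max_lt hγ hγ', fun a ha hle =>
      ⟨h₁ a ha ((le_max_left _ _).trans hle), h₂ a ha ((le_max_right _ _).trans hle)⟩⟩
  · obtain ⟨i₀, h₁⟩ := h.2 δ hδ
    obtain ⟨i₁, h₂⟩ := h'.2 δ hδ
    exact ⟨max i₀ i₁, fun i hi =>
      ⟨h₁ i ((le_max_left _ _).trans hi), h₂ i ((le_max_right _ _).trans hi)⟩⟩

theorem exists_lt_of_mem {α : Initial (Order.succ lam)} (hα : α ∈ D.E) : ∃ γ, γ < α := by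
  obtain ⟨γ, hγ, -⟩ := D.exists_bound α hα ∅ (by simp) (by simpa using D.isRegular.pos)
  exact ⟨γ, hγ⟩

theorem exists_between_of_mem {α b : Initial (Order.succ lam)} (hα : α ∈ D.E) (hb : b < α) :
    ∃ γ < α, b < γ := by
  obtain ⟨γ, hγ, h⟩ := D.exists_bound α hα {b} (by simpa) (by simpa using D.isRegular.nat_lt 1)
  exact ⟨γ, hγ, h b rfl⟩

theorem exists_bound_image {α : Initial (Order.succ lam)} (hα : α ∈ D.E) {T : Type u} (S : Set T)
    (hS : #S < lam) (f : T → Initial (Order.succ lam)) (hf : ∀ t ∈ S, f t < α) :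
    ∃ γ < α, ∀ t ∈ S, f t < γ := by
  obtain ⟨γ, hγ, h⟩ := D.exists_bound α hα (f '' S) (by rintro _ ⟨t, ht, rfl⟩; exact hf t ht)
    (Cardinal.mk_image_le.trans_lt hS)
  exact ⟨γ, hγ, fun t ht => h _ ⟨t, ht, rfl⟩⟩

theorem surrounds_univ (x : Point D) : Surrounds x univ := by
  refine ⟨fun hE _ _ _ => ?_, fun _ _ => ?_⟩
  · obtain ⟨γ, hγ⟩ := exists_lt_of_mem hE
    exact ⟨γ, hγ, fun _ _ _ => mem_univ _⟩
  · obtain ⟨i⟩ := Initial.nonempty D.isRegular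
    exact ⟨i, fun _ _ => mem_univ _⟩

instance : TopologicalSpace (Point D) where
  IsOpen U := ∀ x ∈ U, Surrounds x U
  isOpen_univ := fun x _ => surrounds_univ x
  isOpen_inter := fun _ _ h h' x hx => (h x hx.1).inter (h' x hx.2)
  isOpen_sUnion := fun _ h x ⟨U, hU, hx⟩ => (h U hU x hx).mono (subset_sUnion_of_mem hU)

theorem isOpen_iff {U : Set (Point D)} : IsOpen U ↔ ∀ x ∈ U, Surrounds x U := Iff.rfl

theorem _root_.IsClosed.surrounds_compl {F : Set (Point D)} (hF : IsClosed F) {x : Point D}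
    (hx : x ∉ F) : Surrounds x Fᶜ := isOpen_iff.1 hF.isOpen_compl x hx

theorem isOpen_base_lt (ε : Initial (Order.succ lam)) : IsOpen {x : Point D | x.base < ε} := by
  refine isOpen_iff.2 fun x hx => ⟨fun hE q m _ => ?_, fun δ hδ => ?_⟩
  · obtain ⟨γ, hγ⟩ := exists_lt_of_mem hE
    exact ⟨γ, hγ, fun a ha _ => (D.lt_of_mem_ladder _ hE _ _ a ha).trans hx⟩
  · obtain ⟨i⟩ := Initial.nonempty D.isRegular
    exact ⟨i, fun _ _ => hδ.trans hx⟩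

theorem isOpen_lvl_lt (n : ℕ) : IsOpen {x : Point D | x.lvl < n} := by
  refine isOpen_iff.2 fun x hx => ⟨fun hE q m hm => ?_, fun δ hδ => ?_⟩
  · obtain ⟨γ, hγ⟩ := exists_lt_of_mem hE
    exact ⟨γ, hγ, fun a ha _ => lt_of_le_of_lt hm hx⟩
  · obtain ⟨i⟩ := Initial.nonempty D.isRegular
    exact ⟨i, fun _ _ => hx⟩

instance : T1Space (Point D) := by
  refine ⟨fun y => ⟨isOpen_iff.2 fun x hx => ⟨fun hE q m hm => ?_, fun δ hδ => ?_⟩⟩⟩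
  · by_cases hy : y.base < x.base
    · obtain ⟨γ, hγ, hlt⟩ := exists_between_of_mem hE hy
      refine ⟨γ, hγ, fun a _ hle he => ?_⟩
      rw [← (he : _ = y)] at hlt
      exact absurd hlt (not_lt.2 hle)
    · obtain ⟨γ, hγ⟩ := exists_lt_of_mem hE
      refine ⟨γ, hγ, fun a ha _ he => hy ?_⟩
      rw [← (he : _ = y)]
      exact D.lt_of_mem_ladder _ hE _ _ a ha
  -- The code determines `i`, so `y` occurs at most once along the sequence and a tail avoids it.
  · by_cases hy : ∃ i, (⟨δ, D.code i (D.fn x.base i) x.col, x.lvl⟩ : Point D) = y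
    · obtain ⟨j, rfl⟩ := hy
      obtain ⟨i₀, hi₀⟩ := Initial.exists_gt D.isRegular j
      refine ⟨i₀, fun i hi he => ?_⟩
      have := (D.code_inj _ _ _ _ _ _ (Point.mk.inj he).2.1).1
      exact absurd (hi₀.trans_le hi) (by simp [this])
    · obtain ⟨i⟩ := Initial.nonempty D.isRegular
      exact ⟨i, fun i _ he => hy ⟨i, he⟩⟩

theorem mk_point (D : LadderSystem lam) : #(Point D) = Order.succ lam := by
  have h0 := D.isRegular.aleph0_le
  have e : Point D ≃ Initial (Order.succ lam) × (Initial lam × ULift.{u} ℕ) :=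
    ⟨fun x => (x.base, x.col, ⟨x.lvl⟩), fun x => ⟨x.1, x.2.1, x.2.2.down⟩,
      fun _ => rfl, fun _ => rfl⟩
  rw [Cardinal.mk_congr e]
  simp only [Cardinal.mk_prod, Cardinal.lift_id, Initial.mk_eq]
  rw [Cardinal.mk_uLift, Cardinal.mk_nat, Cardinal.lift_aleph0, Cardinal.mul_aleph0_eq h0,
    Cardinal.mul_eq_left (h0.trans (Order.le_succ _)) (Order.le_succ _) D.isRegular.ne_zero]

theorem mk_base_le (ε : Initial (Order.succ lam)) : #{x : Point D | x.base ≤ ε} ≤ lam := by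
  have h0 := D.isRegular.aleph0_le
  have h1 : #(Iic ε) ≤ lam := Order.lt_succ_iff.1
    (Initial.mk_Iic_lt (Cardinal.isRegular_succ h0) ε)
  have hinj : #{x : Point D | x.base ≤ ε} ≤ #(Iic ε × (Initial lam × ULift.{u} ℕ)) := by
    refine Cardinal.mk_le_of_injective
      (f := fun x => ((⟨x.1.base, x.2⟩ : Iic ε), x.1.col, (⟨x.1.lvl⟩ : ULift.{u} ℕ))) ?_
    intro x y hxy
    simp only [Prod.mk.injEq, ULift.up.injEq] at hxy
    exact Subtype.ext (Point.ext (congrArg Subtype.val hxy.1) hxy.2.1 hxy.2.2)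
  refine hinj.trans ?_
  simp only [Cardinal.mk_prod, Cardinal.lift_id, Initial.mk_eq]
  rw [Cardinal.mk_uLift, Cardinal.mk_nat, Cardinal.lift_aleph0, Cardinal.mul_aleph0_eq h0]
  exact (mul_le_mul_left h1 _).trans (Cardinal.mul_eq_self h0).le

end LadderSystem

/-! ### Disjoint converging sets below a fixed height. -/

namespace LadderSystem

variable {lam : Cardinal.{u}} {D : LadderSystem lam}

/-- An injective indexing of the positions at one height. -/
theorem exists_injective_index (D : LadderSystem lam) :
    ∃ t : Initial lam → ℕ → Initial lam, ∀ q m q' m', t q m = t q' m' → q = q' ∧ m = m' := by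
  have h0 := D.isRegular.aleph0_le
  have h : #(Initial lam × ULift.{u} ℕ) ≤ #(Initial lam) := by
    simp only [Cardinal.mk_prod, Cardinal.lift_id, Initial.mk_eq]
    rw [Cardinal.mk_uLift, Cardinal.mk_nat, Cardinal.lift_aleph0, Cardinal.mul_aleph0_eq h0]
  obtain ⟨e⟩ := h
  refine ⟨fun q m => e (q, ⟨m⟩), fun q m q' m' hqm => ?_⟩
  simpa using hqm

theorem mk_setOf_lt_of_injOn {T : Type u} {S : Set T} {f : T → Initial lam} (hf : InjOn f S)
    (D : LadderSystem lam) (i : Initial lam) : #{a ∈ S | f a ≤ i} < lam :=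
  Initial.mk_lt_of_injOn (hf.mono fun _ h => h.1) (Initial.mk_Iic_lt D.isRegular i)
    fun _ h => h.2

/-- Along the sets `{(δ, code i (fn β i) p)}` the index of the position tends to `lam`. -/
theorem exists_forall_index_gt (t : Initial lam → ℕ → Initial lam)
    (ht : ∀ q m q' m', t q m = t q' m' → q = q' ∧ m = m') (x : Point D) (j : Initial lam) :
    ∃ i₀, ∀ i, i₀ ≤ i → j < t (D.code i (D.fn x.base i) x.col) x.lvl := by
  have hinj : InjOn (fun i => t (D.code i (D.fn x.base i) x.col) x.lvl) univ :=
    fun i _ i' _ h => (D.code_inj _ _ _ _ _ _ (ht _ _ _ _ h).1).1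
  obtain ⟨i₀, hi₀⟩ := Initial.exists_forall_lt D.isRegular _ (mk_setOf_lt_of_injOn hinj D j)
  refine ⟨i₀, fun i hi => ?_⟩
  by_contra hle
  exact absurd (hi₀ i ⟨mem_univ _, not_lt.1 hle⟩) (not_lt.2 hi)

/-- The points below `ε` have pairwise disjoint sets `N g` that contain tails of all sets
converging to `g`, avoid prescribed closed sets, and have only small intersections with the sets
that converge to the points at height at least `ε`. -/
theorem exists_disjoint_surrounds (ε : Initial (Order.succ lam)) (F : Point D → Set (Point D))
    (hF : ∀ g, IsClosed (F g)) (hgF : ∀ g, g ∉ F g) :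
    ∃ N : Point D → Set (Point D),
      (∀ g, g.base < ε → Surrounds g (N g)) ∧
      (∀ g g', g.base < ε → g'.base < ε → g ≠ g' → Disjoint (N g) (N g')) ∧
      (∀ g, g.base < ε → Disjoint (N g) (F g)) ∧
      (∀ g, ∀ y ∈ N g, y.base < g.base) ∧
      ∀ x : Point D, ε ≤ x.base → ∀ δ < ε, ∃ i₀, ∀ i, i₀ ≤ i → ∀ g, g.base < ε →
        (⟨δ, D.code i (D.fn x.base i) x.col, x.lvl⟩ : Point D) ∉ N g := by
  classical
  have hreg := D.isRegular
  obtain ⟨t, ht⟩ := exists_injective_index D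
  obtain ⟨r, hr⟩ := Initial.exists_injOn hreg.ne_zero (mk_base_le (D := D) ε)
  have hr' : InjOn r {g : Point D | g.base < ε} := hr.mono fun g hg => by
    exact (show g.base < ε from hg).le
  obtain ⟨s, hs⟩ := Initial.exists_injOn hreg.ne_zero
    (Order.lt_succ_iff.1 (Initial.mk_Iio_lt ε))
  -- Where to cut the ladder of `g` in column `q` at level `m`: past the heights of small index `s`,
  -- past the intersections with ladders of earlier points, and past `F g`. The first two are fewer
  -- than `lam` requirements, so they stay bounded below `g.base`.
  have hγ : ∀ (g : Point D) (q : Initial lam) (m : ℕ), ∃ γ, g.base < ε → g.base ∈ D.E →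
      γ < g.base ∧ (∀ δ < g.base, s δ ≤ t q m → δ < γ) ∧
      (∀ g' : Point D, g'.base < ε → g'.base ∈ D.E → r g' < r g →
        ∀ a ∈ D.ladder g.base g.col g.lvl, a ∈ D.ladder g'.base g'.col g'.lvl → a < γ) ∧
      (m ≤ g.lvl → ∀ a ∈ D.ladder g.base g.col g.lvl, γ ≤ a → (⟨a, q, m⟩ : Point D) ∉ F g) := by
    intro g q m
    by_cases hg : g.base < ε ∧ g.base ∈ D.E
    swap
    · exact ⟨g.base, fun h h' => absurd ⟨h, h'⟩ hg⟩
    obtain ⟨hgε, hgE⟩ := hg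
    obtain ⟨γ₁, hγ₁, h₁⟩ := D.exists_bound g.base hgE {δ ∈ Iio g.base | s δ ≤ t q m}
      (fun δ h => h.1) (mk_setOf_lt_of_injOn (hs.mono fun δ hδ => lt_trans hδ hgε) D _)
    have hmeet : ∀ g' : Point D, ∃ γ, g'.base ∈ D.E → g' ≠ g → γ < g.base ∧
        ∀ a ∈ D.ladder g.base g.col g.lvl, a ∈ D.ladder g'.base g'.col g'.lvl → a < γ := by
      intro g'
      by_cases h : g'.base ∈ D.E ∧ g' ≠ g
      · obtain ⟨γ, hγ⟩ := D.ladder_inter _ hgE _ h.1 g.col g.lvl g'.col g'.lvl (by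
          intro he
          simp only [Prod.mk.injEq] at he
          exact h.2 (Point.ext he.1 he.2.1 he.2.2).symm)
        exact ⟨γ, fun _ _ => hγ⟩
      · exact ⟨g.base, fun h₁ h₂ => absurd ⟨h₁, h₂⟩ h⟩
    choose f hf using hmeet
    obtain ⟨γ₂, hγ₂, h₂⟩ := exists_bound_image hgE
      {g' | g' ∈ {g' : Point D | g'.base < ε ∧ g'.base ∈ D.E ∧ g' ≠ g} ∧ r g' ≤ r g}
      (mk_setOf_lt_of_injOn (hr.mono fun g' h => le_of_lt h.1) D _) f
      fun g' h => (hf g' h.1.2.1 h.1.2.2).1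
    have h₃ : ∃ γ < g.base, m ≤ g.lvl → ∀ a ∈ D.ladder g.base g.col g.lvl, γ ≤ a →
        (⟨a, q, m⟩ : Point D) ∉ F g := by
      by_cases hm : m ≤ g.lvl
      · obtain ⟨γ, hγ, h⟩ := ((hF g).surrounds_compl (hgF g)).1 hgE q m hm
        exact ⟨γ, hγ, fun _ => h⟩
      · obtain ⟨γ, hγ⟩ := exists_lt_of_mem hgE
        exact ⟨γ, hγ, fun h => absurd h hm⟩
    obtain ⟨γ₃, hγ₃, h₃⟩ := h₃
    refine ⟨max γ₁ (max γ₂ γ₃), fun _ _ => ⟨max_lt hγ₁ (max_lt hγ₂ hγ₃), ?_, ?_, ?_⟩⟩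
    · exact fun δ hδ hsδ => (h₁ δ ⟨hδ, hsδ⟩).trans_le (le_max_left _ _)
    · intro g' hg'ε hg'E hlt a ha ha'
      have hne : g' ≠ g := by rintro rfl; exact lt_irrefl _ hlt
      exact ((hf g' hg'E hne).2 a ha ha').trans <|
        (h₂ g' ⟨⟨hg'ε, hg'E, hne⟩, hlt.le⟩).trans_le
          ((le_max_left _ _).trans (le_max_right _ _))
    · exact fun hm a ha hle => h₃ hm a ha
        (((le_max_right _ _).trans (le_max_right _ _)).trans hle)
  choose γ hγ using hγ
  -- Where to cut the sequence of `g` at height `δ`: beyond this index `fn g.base` is below `fn ε`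
  -- and differs from the functions of earlier points at other heights.
  have hι : ∀ (g : Point D) (δ : Initial (Order.succ lam)), ∃ i₀, g.base < ε → δ < g.base →
      ∀ i, i₀ ≤ i → D.fn g.base i < D.fn ε i ∧
      (∀ g' : Point D, g'.base < ε → r g' < r g → g'.base ≠ g.base →
        D.fn g.base i ≠ D.fn g'.base i) ∧
      s δ < t (D.code i (D.fn g.base i) g.col) g.lvl ∧
      (⟨δ, D.code i (D.fn g.base i) g.col, g.lvl⟩ : Point D) ∉ F g := by
    intro g δ
    by_cases hg : g.base < ε ∧ δ < g.base
    swap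
    · exact ⟨g.col, fun h h' => absurd ⟨h, h'⟩ hg⟩
    obtain ⟨hgε, hδ⟩ := hg
    obtain ⟨i₁, h₁⟩ := D.fn_lt _ _ hgε
    have hdiff : ∀ g' : Point D, ∃ i₀, g'.base ≠ g.base → ∀ i, i₀ ≤ i →
        D.fn g.base i ≠ D.fn g'.base i := by
      intro g'
      rcases lt_trichotomy g'.base g.base with h | h | h
      · obtain ⟨i₀, hi₀⟩ := D.fn_lt _ _ h
        exact ⟨i₀, fun _ i hi => (hi₀ i hi).ne'⟩
      · exact ⟨g.col, fun h' => absurd h h'⟩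
      · obtain ⟨i₀, hi₀⟩ := D.fn_lt _ _ h
        exact ⟨i₀, fun _ i hi => (hi₀ i hi).ne⟩
    choose f hf using hdiff
    obtain ⟨i₂, h₂⟩ := Initial.exists_forall_lt_image hreg
      {g' | g' ∈ {g' : Point D | g'.base < ε} ∧ r g' ≤ r g}
      (mk_setOf_lt_of_injOn hr' D _) f
    obtain ⟨i₃, h₃⟩ := exists_forall_index_gt t ht g (s δ)
    obtain ⟨i₄, h₄⟩ := ((hF g).surrounds_compl (hgF g)).2 δ hδ
    refine ⟨max (max i₁ i₂) (max i₃ i₄), fun _ _ i hi => ?_⟩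
    simp only [max_le_iff] at hi
    exact ⟨h₁ i hi.1.1, fun g' hg' hlt hne => hf g' hne i ((h₂ g' ⟨hg', hlt.le⟩).le.trans hi.1.2),
      h₃ i hi.2.1, h₄ i hi.2.2⟩
  choose ι hι using hι
  let N₁ : Point D → Set (Point D) := fun g => {y | g.base < ε ∧ g.base ∈ D.E ∧
    y.base ∈ D.ladder g.base g.col g.lvl ∧ y.lvl ≤ g.lvl ∧ γ g y.col y.lvl ≤ y.base}
  let N₂ : Point D → Set (Point D) := fun g => {y | g.base < ε ∧ y.base < g.base ∧
    ∃ i, ι g y.base ≤ i ∧ y.col = D.code i (D.fn g.base i) g.col ∧ y.lvl = g.lvl}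
  -- Comparing the index `s` of the height with the index `t` of the position keeps the two kinds of
  -- sets apart: `t < s` on every `N₁ g`, and `s < t` on every `N₂ g`.
  have hN₁ : ∀ g, ∀ y ∈ N₁ g, y.base < g.base ∧ t y.col y.lvl < s y.base := by
    rintro g y ⟨hgε, hgE, hy, -, hle⟩
    have hlt := D.lt_of_mem_ladder _ hgE _ _ _ hy
    refine ⟨hlt, ?_⟩
    by_contra hst
    exact absurd ((hγ g _ _ hgε hgE).2.1 _ hlt (not_lt.1 hst)) (not_lt.2 hle)
  have hN₂ : ∀ g, ∀ y ∈ N₂ g, s y.base < t y.col y.lvl := by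
    rintro g y ⟨hgε, hlt, i, hi, hcol, hlvl⟩
    rw [hcol, hlvl]
    exact (hι g _ hgε hlt i hi).2.2.1
  have hdisj : ∀ g g' : Point D, g.base < ε → g'.base < ε → r g' < r g →
      Disjoint (N₁ g ∪ N₂ g) (N₁ g' ∪ N₂ g') := by
    intro g g' hg hg' hlt
    rw [Set.disjoint_left]
    rintro y (hy | hy) (hy' | hy')
    · obtain ⟨hgε, hgE, hyL, -, hle⟩ := hy
      obtain ⟨-, hgE', hyL', -, -⟩ := hy'
      exact absurd ((hγ g _ _ hgε hgE).2.2.1 g' hg' hgE' hlt _ hyL hyL') (not_lt.2 hle)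
    · exact lt_asymm (hN₁ _ _ hy).2 (hN₂ _ _ hy')
    · exact lt_asymm (hN₁ _ _ hy').2 (hN₂ _ _ hy)
    · obtain ⟨-, hb, i, hi, hcol, hlvl⟩ := hy
      obtain ⟨-, hb', i', hi', hcol', hlvl'⟩ := hy'
      obtain ⟨rfl, hfn, hc⟩ := D.code_inj _ _ _ _ _ _ (hcol.symm.trans hcol')
      have hne : g'.base ≠ g.base := fun h => by
        have : g' = g := Point.ext h hc.symm (hlvl'.symm.trans hlvl)
        exact absurd hlt (by simp [this])
      exact (hι g _ hg hb i hi).2.1 g' hg' hlt hne hfn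
  refine ⟨fun g => N₁ g ∪ N₂ g, fun g hg => ⟨fun hE q m hm => ?_, fun δ hδ => ?_⟩,
    fun g g' hg hg' hne => ?_, fun g hg => ?_, ?_, fun x hx δ hδ => ?_⟩
  · exact ⟨γ g q m, (hγ g q m hg hE).1, fun a ha hle => Or.inl ⟨hg, hE, ha, hm, hle⟩⟩
  · exact ⟨ι g δ, fun i hi => Or.inr ⟨hg, hδ, i, hi, rfl, rfl⟩⟩
  · rcases lt_trichotomy (r g) (r g') with h | h | h
    · exact (hdisj g' g hg' hg h).symm
    · exact absurd (hr hg.le hg'.le h) hne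
    · exact hdisj g g' hg hg' h
  · rw [Set.disjoint_left]
    rintro y (⟨hgε, hgE, hyL, hlvl, hle⟩ | ⟨hgε, hb, i, hi, hcol, hlvl⟩) hyF
    · exact (hγ g _ _ hgε hgE).2.2.2 hlvl _ hyL hle hyF
    · refine (hι g _ hgε hb i hi).2.2.2 ?_
      rwa [← hcol, ← hlvl]
  · rintro g y (hy | hy)
    · exact (hN₁ _ _ hy).1
    · exact hy.2.1
  -- Eventually `fn g.base i < fn ε i ≤ fn x.base i`, with the first inequality built into `N₂ g`.
  -- Equal codes are thus impossible, by a bound on `i` that is uniform in `g`.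
  · have hle : ∃ i₀, ∀ i, i₀ ≤ i → D.fn ε i ≤ D.fn x.base i := by
      rcases hx.eq_or_lt with h | h
      · exact ⟨x.col, fun i _ => by rw [h]⟩
      · obtain ⟨i₀, hi₀⟩ := D.fn_lt _ _ h
        exact ⟨i₀, fun i hi => (hi₀ i hi).le⟩
    obtain ⟨i₁, h₁⟩ := hle
    obtain ⟨i₂, h₂⟩ := exists_forall_index_gt t ht x (s δ)
    refine ⟨max i₁ i₂, fun i hi g hg hmem => ?_⟩
    rcases hmem with hmem | ⟨-, hb, j, hj, hcol, -⟩
    · exact lt_asymm (hN₁ _ _ hmem).2 (h₂ i ((le_max_right _ _).trans hi))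
    · obtain ⟨rfl, hfn, -⟩ := D.code_inj _ _ _ _ _ _ hcol
      have h3 := (hι g _ hg hb i hj).1
      have h4 := h₁ i ((le_max_left _ _).trans hi)
      rw [hfn] at h4
      exact absurd h3 (not_lt.2 h4)

end LadderSystem

/-! ### Discrete families and separation of their bounded members. -/

section DiscreteFamily

variable {X : Type u} [TopologicalSpace X] {ι : Type u} {K : ι → Set X}

theorem IsDiscreteFamily.isClosed_biUnion (hK : IsDiscreteFamily K) (hc : ∀ i, IsClosed (K i))
    (J : Set ι) : IsClosed (⋃ i ∈ J, K i) := by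
  have hlf : LocallyFinite K := fun x => by
    obtain ⟨U, hU, hx, hs⟩ := hK x
    refine ⟨U, hU.mem_nhds hx, ?_⟩
    simpa only [inter_comm] using hs.finite
  rw [biUnion_eq_iUnion]
  exact (hlf.comp_injective Subtype.val_injective).isClosed_iUnion fun i => hc i

theorem IsDiscreteFamily.eq_of_mem (hK : IsDiscreteFamily K) {x : X} {i j : ι} (hi : x ∈ K i)
    (hj : x ∈ K j) : i = j := by
  obtain ⟨U, -, hx, hs⟩ := hK x
  exact hs ⟨x, hx, hi⟩ ⟨x, hx, hj⟩

end DiscreteFamily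

namespace LadderSystem

variable {lam : Cardinal.{u}} {D : LadderSystem lam}

/-- The members of a discrete family of closed sets that lie below a height `ε ∉ E` have disjoint
open neighborhoods with closed union that avoid all the other members. -/
theorem exists_separation_of_bounded {ι : Type u} {K : ι → Set (Point D)}
    (hc : ∀ i, IsClosed (K i)) (hK : IsDiscreteFamily K) (J : Set ι)
    (ε : Initial (Order.succ lam)) (hε : ε ∉ D.E) (hJ : ∀ i ∈ J, ∀ x ∈ K i, x.base < ε) :
    ∃ U : ι → Set (Point D), (∀ i ∈ J, IsOpen (U i)) ∧ (∀ i ∈ J, K i ⊆ U i) ∧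
      (∀ i ∈ J, ∀ j, i ≠ j → Disjoint (U i) (K j)) ∧
      (∀ i ∈ J, ∀ j ∈ J, i ≠ j → Disjoint (U i) (U j)) ∧ IsClosed (⋃ i ∈ J, U i) := by
  -- The set to avoid at `g` is the union of the members not containing `g`. A point of `K j` can
  -- then lie in `N g` only if `g` is itself in `K j`.
  obtain ⟨N, hN, hNd, hNF, hNlt, hNε⟩ := exists_disjoint_surrounds (D := D) ε
    (fun g => ⋃ i ∈ {i | g ∉ K i}, K i) (fun g => hK.isClosed_biUnion hc _) (by simp)
  let R : Point D → Point D → Prop := fun y g => g.base < ε ∧ y ∈ N g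
  have hRu : Relator.RightUnique R := by
    rintro y g g' ⟨hg, hy⟩ ⟨hg', hy'⟩
    by_contra hne
    exact Set.disjoint_left.1 (hNd g g' hg hg' hne) hy hy'
  have hRK : ∀ {j y z}, Relation.ReflTransGen R y z → y ∈ K j → z ∈ K j := by
    intro j y z h hy
    induction h with
    | refl => exact hy
    | @tail b z _ hbz ih =>
      by_contra hz
      exact Set.disjoint_left.1 (hNF z hbz.1) hbz.2 (mem_biUnion (show j ∈ {i | z ∉ K i} from hz) ih)
  -- The points from which a finite chain of memberships in the sets `N` leads to `K i`. As the sets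
  -- `N g` are disjoint, each point has at most one successor, so two chains from one point are
  -- comparable.
  let U : ι → Set (Point D) := fun i => {y | ∃ z ∈ K i, Relation.ReflTransGen R y z}
  have hUlt : ∀ i ∈ J, ∀ y ∈ U i, y.base < ε := by
    rintro i hi y ⟨z, hz, hyz⟩
    rcases Relation.ReflTransGen.cases_head hyz with rfl | ⟨g, hg, -⟩
    · exact hJ i hi _ hz
    · exact (hNlt g y hg.2).trans hg.1
  have hKU : ∀ i, K i ⊆ U i := fun i x hx => ⟨x, hx, .refl⟩
  refine ⟨U, fun i hi => isOpen_iff.2 fun x hx => ?_, fun i _ => hKU i, fun i hi j hij => ?_,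
    fun i hi j hj hij => ?_, ⟨isOpen_iff.2 fun x hx => ?_⟩⟩
  · refine (hN x (hUlt i hi x hx)).mono fun y hy => ?_
    obtain ⟨z, hz, hxz⟩ := hx
    exact ⟨z, hz, .head ⟨hUlt i hi x ⟨z, hz, hxz⟩, hy⟩ hxz⟩
  · rw [Set.disjoint_left]
    rintro y ⟨z, hz, hyz⟩ hy
    exact hij (hK.eq_of_mem hz (hRK hyz hy))
  · rw [Set.disjoint_left]
    rintro y ⟨z, hz, hyz⟩ ⟨z', hz', hyz'⟩
    rcases Relation.ReflTransGen.total_of_right_unique hRu hyz hyz' with h | h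
    · exact hij (hK.eq_of_mem (hRK h hz) hz')
    · exact hij (hK.eq_of_mem hz (hRK h hz'))
  · have hxK : x ∉ ⋃ i ∈ J, K i := fun h => by
      obtain ⟨i, hi, hxi⟩ := mem_iUnion₂.1 h
      exact hx (mem_biUnion hi (hKU i hxi))
    rcases lt_or_ge x.base ε with hxε | hxε
    -- A point of `N x` has `x` as its only successor, so a nontrivial chain from it into some `K i`
    -- passes through `x` and would put `x` into the union.
    · refine (((hN x hxε).inter ((hK.isClosed_biUnion hc J).surrounds_compl hxK))).mono ?_
      rintro y ⟨hyN, hyK⟩ hyU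
      obtain ⟨i, hi, z, hz, hyz⟩ := mem_iUnion₂.1 hyU
      rcases Relation.ReflTransGen.cases_head hyz with rfl | ⟨g, hg, hgz⟩
      · exact hyK (mem_biUnion hi hz)
      · have hgx : g = x := hRu hg ⟨hxε, hyN⟩
        exact hx (mem_biUnion hi ⟨z, hz, hgx ▸ hgz⟩)
    · have hcompl := (hK.isClosed_biUnion hc J).surrounds_compl hxK
      refine ⟨fun hE q m hm => ?_, fun δ hδ => ?_⟩
      -- This is where `ε ∉ E` matters: a ladder converging to height `ε` itself could not be cut
      -- above `ε`.
      · have hlt : ε < x.base := lt_of_le_of_ne hxε fun h => hε (h ▸ hE)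
        refine ⟨ε, hlt, fun a _ hle hmem => ?_⟩
        obtain ⟨i, hi, hU⟩ := mem_iUnion₂.1 hmem
        exact absurd (hUlt i hi _ hU) (not_lt.2 hle)
      · rcases lt_or_ge δ ε with hδε | hδε
        · obtain ⟨i₁, h₁⟩ := hNε x hxε δ hδε
          obtain ⟨i₂, h₂⟩ := hcompl.2 δ hδ
          refine ⟨max i₁ i₂, fun i hi hmem => ?_⟩
          obtain ⟨j, hj, z, hz, hyz⟩ := mem_iUnion₂.1 hmem
          rcases Relation.ReflTransGen.cases_head hyz with rfl | ⟨g, hg, hgz⟩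
          · exact h₂ i ((le_max_right _ _).trans hi) (mem_biUnion hj hz)
          · exact h₁ i ((le_max_left _ _).trans hi) g hg.1 hg.2
        · refine ⟨x.col, fun i _ hmem => ?_⟩
          obtain ⟨j, hj, hU⟩ := mem_iUnion₂.1 hmem
          exact absurd (hUlt j hj _ hU) (not_lt.2 hδε)

end LadderSystem

/-! ### A criterion for a non-normal product. -/

/-- A space with a decreasing sequence of closed sets with empty intersection all of whose open
expansions have nonempty intersection has a non-normal product with the unit interval. -/
theorem not_normalSpace_prod_unitInterval {X : Type u} [TopologicalSpace X] (C : ℕ → Set X)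
    (hC : ∀ n, IsClosed (C n)) (hanti : Antitone C) (hempty : ⋂ n, C n = ∅)
    (hexp : ∀ U : ℕ → Set X, (∀ n, IsOpen (U n)) → (∀ n, C n ⊆ U n) → (⋂ n, U n).Nonempty) :
    ¬ NormalSpace (X × unitInterval) := by
  intro hnormal
  have hs : ∀ n : ℕ, (1 : ℝ) / (n + 1) ∈ Icc (0 : ℝ) 1 := fun n =>
    ⟨by positivity, by rw [div_le_one (by positivity)]; simp⟩
  let s : ℕ → unitInterval := fun n => ⟨1 / (n + 1), hs n⟩
  have hsanti : ∀ m n : ℕ, n ≤ m → s m ≤ s n := fun m n h =>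
    Subtype.mk_le_mk.2 (Nat.one_div_le_one_div h)
  have hspos : ∀ n, 0 < s n := fun n => Subtype.mk_lt_mk.2 (by positivity)
  have hslim : Filter.Tendsto s Filter.atTop (nhds 0) :=
    tendsto_subtype_rng.2 (tendsto_one_div_add_atTop_nhds_zero_nat (𝕜 := ℝ))
  have hA : IsClosed {z : X × unitInterval | z.2 = 0} :=
    isClosed_singleton.preimage continuous_snd
  -- The region above a staircase: each `x` misses some `C n`, so its fibre stays above `s n > 0`.
  -- The slice at height `s n` contains `C n`, so the slices of a neighborhood form an open
  -- expansion.
  have hB : IsClosed {z : X × unitInterval | ∀ n, z.1 ∉ C n → s n ≤ z.2} := by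
    have : {z : X × unitInterval | ∀ n, z.1 ∉ C n → s n ≤ z.2} =
        ⋂ n, (Prod.fst ⁻¹' C n ∪ Prod.snd ⁻¹' Ici (s n)) := by
      ext z
      simp [or_iff_not_imp_left]
    rw [this]
    exact isClosed_iInter fun n =>
      ((hC n).preimage continuous_fst).union (isClosed_Ici.preimage continuous_snd)
  have hdisj : Disjoint {z : X × unitInterval | z.2 = 0}
      {z : X × unitInterval | ∀ n, z.1 ∉ C n → s n ≤ z.2} := by
    rw [Set.disjoint_left]
    rintro ⟨x, t⟩ (rfl : t = 0) hz
    have hx : x ∉ ⋂ n, C n := by simp [hempty]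
    obtain ⟨n, hn⟩ := by simpa using hx
    exact absurd (hz n hn) (not_le.2 (hspos n))
  obtain ⟨U, V, hU, hV, hAU, hBV, hUV⟩ := normal_separation hA hB hdisj
  obtain ⟨x, hx⟩ := hexp (fun n => (fun x => (x, s n)) ⁻¹' V)
    (fun n => hV.preimage (by fun_prop)) (fun n x hx => hBV fun m hm => by
      refine hsanti m n ?_
      by_contra! hlt
      exact hm (hanti hlt.le hx))
  rw [mem_iInter] at hx
  have hlim : Filter.Tendsto (fun n => (x, s n)) Filter.atTop (nhds (x, 0)) :=
    tendsto_const_nhds.prodMk_nhds hslim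
  obtain ⟨n, hn⟩ := (hlim.eventually (hU.mem_nhds (hAU rfl))).exists
  exact Set.disjoint_left.1 hUV hn (hx n)

theorem IsCollectionwiseNormal.normalSpace {X : Type u} [TopologicalSpace X]
    (h : IsCollectionwiseNormal X) : NormalSpace X := by
  refine ⟨fun s t hs ht hst => ?_⟩
  obtain ⟨U, hU, hsub, hdisj⟩ := h (ULift.{u} Bool) (fun b => if b.down then s else t)
    (fun ⟨b⟩ => by cases b <;> simpa) (fun x => by
      by_cases hx : x ∈ s
      · refine ⟨tᶜ, ht.isOpen_compl, Set.disjoint_left.1 hst hx, ?_⟩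
        rintro ⟨_ | _⟩ hi ⟨_ | _⟩ hj <;> simp at hi hj ⊢
      · refine ⟨sᶜ, hs.isOpen_compl, hx, ?_⟩
        rintro ⟨_ | _⟩ hi ⟨_ | _⟩ hj <;> simp at hi hj ⊢)
  exact ⟨U ⟨true⟩, U ⟨false⟩, hU _, hU _, by simpa using hsub ⟨true⟩, by simpa using hsub ⟨false⟩,
    hdisj _ _ (by simp)⟩

/-! ### Unbounded closed sets and the properties of the space. -/

namespace LadderSystem

variable {lam : Cardinal.{u}} {D : LadderSystem lam}

theorem isRegular_succ (D : LadderSystem lam) : (Order.succ lam).IsRegular :=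
  Cardinal.isRegular_succ D.isRegular.aleph0_le

/-- An unbounded set of points at a fixed position has a bounded part whose closure contains all
points of greater height and level. -/
theorem exists_height_forall_mem (Y : Set (Initial (Order.succ lam))) (hY : ∀ b, ∃ a ∈ Y, b ≤ a)
    (q : Initial lam) (m : ℕ) : ∃ α, ∀ F : Set (Point D), IsClosed F →
      (∀ a ∈ Y, a < α → (⟨a, q, m⟩ : Point D) ∈ F) →
      ∀ x : Point D, α < x.base → m ≤ x.lvl → x ∈ F := by
  obtain ⟨α, hα, hguess⟩ := D.guess Y hY
  refine ⟨α, fun F hF hYF x hx hm => ?_⟩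
  -- All ladders at `α` meet `Y` cofinally, and a ladder of level `n` converges in every column at
  -- every level up to `n`.
  have hαF : ∀ p n, m ≤ n → (⟨α, p, n⟩ : Point D) ∈ F := by
    intro p n hn
    by_contra hnot
    obtain ⟨γ, hγ, h⟩ := (hF.surrounds_compl hnot).1 hα q m hn
    obtain ⟨a, haL, haY, hle⟩ := hguess p n γ hγ
    exact h a haL hle (hYF a haY (D.lt_of_mem_ladder _ hα _ _ a haL))
  by_contra hnot
  obtain ⟨i, h⟩ := (hF.surrounds_compl hnot).2 α hx
  exact h i le_rfl (hαF _ _ hm)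

theorem exists_forall_lt_of_forall {B : Initial lam → ℕ → Initial (Order.succ lam)}
    (D : LadderSystem lam) : ∃ b, ∀ q m, B q m < b := by
  have h0 := D.isRegular.aleph0_le
  obtain ⟨b, hb⟩ := Initial.exists_forall_lt_image D.isRegular_succ
    (univ : Set (Initial lam × ULift.{u} ℕ)) (by
      rw [Cardinal.mk_univ]
      simp only [Cardinal.mk_prod, Cardinal.lift_id, Initial.mk_eq]
      rw [Cardinal.mk_uLift, Cardinal.mk_nat, Cardinal.lift_aleph0, Cardinal.mul_aleph0_eq h0]
      exact Order.lt_succ lam) (fun z => B z.1 z.2.down)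
  exact ⟨b, fun q m => hb (q, ⟨m⟩) (mem_univ _)⟩

/-- An unbounded closed set contains all points of sufficiently large height and level. -/
theorem exists_forall_mem_of_unbounded {F : Set (Point D)} (hF : IsClosed F)
    (hun : ∀ b, ∃ x ∈ F, b ≤ x.base) :
    ∃ α n, ∀ x : Point D, α < x.base → n ≤ x.lvl → x ∈ F := by
  by_cases h : ∃ q m, ∀ b, ∃ a, (⟨a, q, m⟩ : Point D) ∈ F ∧ b ≤ a
  · obtain ⟨q, m, h⟩ := h
    obtain ⟨α, hα⟩ := exists_height_forall_mem (D := D) {a | (⟨a, q, m⟩ : Point D) ∈ F} h q m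
    exact ⟨α, m, hα F hF fun a ha _ => ha⟩
  · push Not at h
    choose B hB using h
    obtain ⟨b, hb⟩ := D.exists_forall_lt_of_forall (B := B)
    obtain ⟨x, hx, hle⟩ := hun b
    exact absurd ((hB x.col x.lvl x.base hx).trans (hb x.col x.lvl)) (not_lt.2 hle)

/-- Two unbounded closed sets would share every point of sufficiently large height and level. -/
theorem bounded_or_bounded {H K : Set (Point D)} (hH : IsClosed H) (hK : IsClosed K)
    (hHK : Disjoint H K) : (∃ b, ∀ x ∈ H, x.base < b) ∨ ∃ b, ∀ x ∈ K, x.base < b := by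
  by_contra! h
  obtain ⟨α, n, hα⟩ := exists_forall_mem_of_unbounded hH h.1
  obtain ⟨β, m, hβ⟩ := exists_forall_mem_of_unbounded hK h.2
  obtain ⟨b, hb⟩ := Initial.exists_gt D.isRegular_succ (max α β)
  obtain ⟨p⟩ := Initial.nonempty D.isRegular
  exact Set.disjoint_left.1 hHK
    (hα ⟨b, p, max n m⟩ ((le_max_left _ _).trans_lt hb) (le_max_left _ _))
    (hβ ⟨b, p, max n m⟩ ((le_max_right _ _).trans_lt hb) (le_max_right _ _))

theorem mk_le_of_bounded {T : Type u} {f : T → Point D} (hf : Function.Injective f)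
    {b : Initial (Order.succ lam)} (hb : ∀ t, (f t).base < b) : #T ≤ lam :=
  (Cardinal.mk_le_of_injective (f := fun t => (⟨f t, (hb t).le⟩ : {x : Point D | x.base ≤ b}))
    fun _ _ h => hf (congrArg Subtype.val h)).trans (mk_base_le b)

/-- All members of a discrete family of closed sets but at most one lie below a fixed height. -/
theorem exists_bounded_of_discrete {ι : Type u} {K : ι → Set (Point D)}
    (hc : ∀ i, IsClosed (K i)) (hK : IsDiscreteFamily K) :
    ∃ J : Set ι, Jᶜ.Subsingleton ∧ ∃ b, ∀ i ∈ J, ∀ x ∈ K i, x.base < b := by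
  by_cases hex : ∃ i, ∀ b, ∃ x ∈ K i, b ≤ x.base
  · obtain ⟨i, hi⟩ := hex
    refine ⟨{i}ᶜ, by simp, ?_⟩
    rcases bounded_or_bounded (hc i) (hK.isClosed_biUnion hc {i}ᶜ) (by
      rw [Set.disjoint_left]
      intro x hx hx'
      obtain ⟨j, hj, hxj⟩ := mem_iUnion₂.1 hx'
      exact hj (hK.eq_of_mem hxj hx)) with ⟨b, hb⟩ | ⟨b, hb⟩
    · obtain ⟨x, hx, hle⟩ := hi b
      exact absurd (hb x hx) (not_lt.2 hle)
    · exact ⟨b, fun j hj x hx => hb x (mem_biUnion hj hx)⟩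
  push Not at hex
  choose B hB using hex
  refine ⟨univ, by simp, ?_⟩
  let T : Set ι := {i | (K i).Nonempty}
  rcases le_or_gt #T lam with hT | hT
  · obtain ⟨b, hb⟩ := Initial.exists_forall_lt_image D.isRegular_succ T (Order.lt_succ_iff.2 hT) B
    exact ⟨b, fun i _ x hx => (hB i x hx).trans (hb i ⟨x, hx⟩)⟩
  exfalso
  -- Splitting the more than `lam` nonempty members into two halves of full size gives two disjoint
  -- closed unions. One of them is bounded, which puts more than `lam` points below one height.
  have hTT : #(T ⊕ T) = #T := by
    simp [Cardinal.add_eq_self (D.isRegular.aleph0_le.trans hT.le)]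
  obtain ⟨e⟩ := Cardinal.eq.1 hTT
  have hpt : ∀ i : T, ∃ x, x ∈ K i := fun i => i.2
  choose pt hpt using hpt
  have hptinj : Function.Injective pt := fun i j h =>
    Subtype.ext (hK.eq_of_mem (hpt i) (h ▸ hpt j))
  rcases bounded_or_bounded (hK.isClosed_biUnion hc (range fun i => (e (.inl i) : ι)))
    (hK.isClosed_biUnion hc (range fun i => (e (.inr i) : ι))) (by
      rw [Set.disjoint_left]
      intro x hx hx'
      obtain ⟨_, ⟨i, rfl⟩, hi⟩ := mem_iUnion₂.1 hx
      obtain ⟨_, ⟨j, rfl⟩, hj⟩ := mem_iUnion₂.1 hx'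
      have := e.injective (Subtype.ext (hK.eq_of_mem hi hj))
      simp at this) with ⟨b, hb⟩ | ⟨b, hb⟩
  · refine absurd (mk_le_of_bounded (f := fun i => pt (e (.inl i)))
      (hptinj.comp (e.injective.comp Sum.inl_injective)) (b := b) fun i => ?_) (not_le.2 hT)
    exact hb _ (mem_biUnion ⟨i, rfl⟩ (hpt _))
  · refine absurd (mk_le_of_bounded (f := fun i => pt (e (.inr i)))
      (hptinj.comp (e.injective.comp Sum.inr_injective)) (b := b) fun i => ?_) (not_le.2 hT)
    exact hb _ (mem_biUnion ⟨i, rfl⟩ (hpt _))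

/-- Successors are never in `E`, since below a member of `E` every element has a strictly larger
one. -/
theorem exists_gt_notMem (D : LadderSystem lam) (b : Initial (Order.succ lam)) :
    ∃ ε, b < ε ∧ ε ∉ D.E := by
  obtain ⟨c, hc⟩ := Initial.exists_gt D.isRegular_succ b
  have hlt : b < Order.succ b := Order.lt_succ_of_not_isMax hc.not_isMax
  refine ⟨Order.succ b, hlt, fun hE => ?_⟩
  obtain ⟨γ, hγ, hbγ⟩ := exists_between_of_mem hE hlt
  exact absurd hγ (not_lt.2 (Order.succ_le_of_lt hbγ))

theorem isCollectionwiseNormal (D : LadderSystem lam) : IsCollectionwiseNormal (Point D) := by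
  classical
  intro ι K hc hK
  obtain ⟨J, hJ, b, hb⟩ := exists_bounded_of_discrete hc hK
  obtain ⟨ε, hε, hεE⟩ := D.exists_gt_notMem b
  obtain ⟨U, hUo, hKU, hUK, hUd, hUc⟩ := exists_separation_of_bounded hc hK J ε hεE
    fun i hi x hx => (hb i hi x hx).trans hε
  -- The at most one remaining member receives the complement of the closed union of the other
  -- neighborhoods.
  refine ⟨fun i => if i ∈ J then U i else (⋃ j ∈ J, U j)ᶜ, fun i => ?_, fun i => ?_,
    fun i j hij => ?_⟩
  · by_cases hi : i ∈ J
    · simpa only [hi, if_true] using hUo i hi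
    · simpa only [hi, if_false] using hUc.isOpen_compl
  · by_cases hi : i ∈ J
    · simpa only [hi, if_true] using hKU i hi
    · simp only [hi, if_false]
      intro x hx hxU
      obtain ⟨j, hj, hxj⟩ := mem_iUnion₂.1 hxU
      exact Set.disjoint_left.1 (hUK j hj i (fun h => hi (h ▸ hj))) hxj hx
  · by_cases hi : i ∈ J <;> by_cases hj : j ∈ J
    · simpa only [hi, hj, if_true] using hUd i hi j hj hij
    · simp only [hi, hj, if_true, if_false]
      exact disjoint_compl_right_iff_subset.2 (subset_biUnion_of_mem hi)
    · simp only [hi, hj, if_true, if_false]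
      exact (disjoint_compl_right_iff_subset.2 (subset_biUnion_of_mem hj)).symm
    · exact absurd (hJ hi hj) hij

theorem isDowker (D : LadderSystem lam) : IsDowker (Point D) := by
  have hnorm : NormalSpace (Point D) := D.isCollectionwiseNormal.normalSpace
  have hT4 : T4Space (Point D) := { }
  refine ⟨inferInstance, hnorm, ?_⟩
  refine not_normalSpace_prod_unitInterval (fun n => {x : Point D | x.lvl < n}ᶜ)
    (fun n => (isOpen_lvl_lt n).isClosed_compl) ?_ ?_ ?_
  · intro m n hmn
    refine compl_subset_compl.2 fun x hx => ?_
    exact lt_of_lt_of_le hx hmn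
  · ext x
    simp only [mem_iInter, mem_compl_iff, mem_ofPred_eq, not_lt, mem_empty_iff_false, iff_false,
      not_forall, not_le]
    exact ⟨x.lvl + 1, Nat.lt_succ_self _⟩
  · intro U hU hCU
    -- An unbounded complement of `U n` would contain points of level at least `n`, which lie in `U
    -- n`. Countably many bounds below `λ⁺` have a common bound, and any point above it lies in
    -- every `U n`.
    have hbd : ∀ n, ∃ b, ∀ x, x ∉ U n → x.base < b := by
      intro n
      by_contra! h
      obtain ⟨α, m, hα⟩ := exists_forall_mem_of_unbounded (hU n).isClosed_compl
        (fun b => by simpa using h b)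
      obtain ⟨b, hb⟩ := Initial.exists_gt D.isRegular_succ α
      obtain ⟨p⟩ := Initial.nonempty D.isRegular
      exact hα ⟨b, p, max m n⟩ hb (le_max_left _ _) (hCU n (by simp))
    choose B hB using hbd
    obtain ⟨b, hb⟩ := D.exists_forall_lt_of_forall (B := fun _ n => B n)
    obtain ⟨p⟩ := Initial.nonempty D.isRegular
    refine ⟨⟨b, p, 0⟩, mem_iInter.2 fun n => ?_⟩
    by_contra hn
    exact lt_asymm (hb p n) (hB n _ hn)

theorem hereditaryDensity_eq (D : LadderSystem lam) : hereditaryDensity (Point D) = lam := by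
  have hmem : lam ∈ {μ | ℵ₀ ≤ μ ∧ ∀ Y : Set (Point D), ∃ S : Set Y, Dense S ∧ #S ≤ μ} := by
    refine ⟨D.isRegular.aleph0_le, fun Y => ?_⟩
    -- Each of the `lam` many fixed positions is handled separately: if `Y` is unbounded there, an
    -- initial part is already dense in that slice of `Y`.
    have hα : ∀ q m, ∃ α, ∀ F : Set (Point D), IsClosed F →
        (∀ x ∈ Y, x.base ≤ α → x.col = q → x.lvl = m → x ∈ F) →
        ∀ x ∈ Y, x.col = q → x.lvl = m → x ∈ F := by
      intro q m
      by_cases h : ∀ b, ∃ a ∈ {a | (⟨a, q, m⟩ : Point D) ∈ Y}, b ≤ a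
      · obtain ⟨α, hα⟩ := exists_height_forall_mem (D := D) _ h q m
        refine ⟨α, fun F hF hYF x hx hq hm => ?_⟩
        rcases le_or_gt x.base α with hle | hlt
        · exact hYF x hx hle hq hm
        · exact hα F hF (fun a ha hlt => hYF _ ha hlt.le rfl rfl) x hlt hm.ge
      · push Not at h
        obtain ⟨b, hb⟩ := h
        refine ⟨b, fun F hF hYF x hx hq hm => hYF x hx (hb x.base ?_).le hq hm⟩
        subst hq hm
        exact hx
    choose A hA using hα
    obtain ⟨b, hb⟩ := D.exists_forall_lt_of_forall (B := A)
    refine ⟨{y | (y : Point D).base ≤ b}, fun y => ?_, ?_⟩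
    · rw [closure_subtype]
      refine hA y.1.col y.1.lvl _ isClosed_closure (fun x hx hle hq hm => subset_closure ?_) y y.2
        rfl rfl
      exact ⟨⟨x, hx⟩, hle.trans (hb _ _).le, rfl⟩
    · refine (Cardinal.mk_le_of_injective
        (f := fun y => (⟨y.1.1, y.2⟩ : {x : Point D | x.base ≤ b})) ?_).trans (mk_base_le b)
      intro y z h
      exact Subtype.ext (Subtype.ext (Subtype.mk.inj h))
  refine le_antisymm (csInf_le' hmem) (le_csInf ⟨_, hmem⟩ ?_)
  rintro μ ⟨-, hμ⟩
  obtain ⟨b, -, hb⟩ := (wellFounded_lt (α := Initial (Order.succ lam))).has_min univ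
    (by have := Initial.nonempty D.isRegular_succ; exact univ_nonempty)
  obtain ⟨S, hS, hSμ⟩ := hμ {x | x.base = b}
  -- At the least height nothing converges to a point, so the bottom row is a discrete subspace with
  -- at least `lam` points.
  have hopen : ∀ x : Point D, x.base = b → IsOpen {x} := by
    rintro x rfl
    refine isOpen_iff.2 ?_
    rintro _ rfl
    refine ⟨fun hE => ?_, fun δ hδ => absurd hδ (hb δ (mem_univ _))⟩
    obtain ⟨γ, hγ⟩ := exists_lt_of_mem hE
    exact absurd hγ (hb γ (mem_univ _))
  have hSuniv : ∀ y, y ∈ S := by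
    intro y
    obtain ⟨z, hz, hzS⟩ := hS.inter_open_nonempty (Subtype.val ⁻¹' {(y : Point D)})
      ((hopen y y.2).preimage continuous_subtype_val) ⟨y, rfl⟩
    rwa [← Subtype.ext (hz : (z : Point D) = y)]
  refine (Initial.mk_eq lam).symm.le.trans (le_trans ?_ hSμ)
  refine Cardinal.mk_le_of_injective (f := fun i : Initial lam =>
    (⟨⟨⟨b, i, 0⟩, rfl⟩, hSuniv _⟩ : S)) fun i j h => ?_
  simpa using h

theorem lindelofDegree_eq (D : LadderSystem lam) :
    lindelofDegree (Point D) = Order.succ lam := by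
  have hmem : Order.succ lam ∈ {μ | ℵ₀ ≤ μ ∧ ∀ 𝒰 : Set (Set (Point D)), (∀ U ∈ 𝒰, IsOpen U) →
      ⋃₀ 𝒰 = univ → ∃ 𝒱 ⊆ 𝒰, #𝒱 ≤ μ ∧ ⋃₀ 𝒱 = univ} := by
    refine ⟨D.isRegular_succ.aleph0_le, fun 𝒰 _ hcov => ?_⟩
    have h : ∀ x : Point D, ∃ U ∈ 𝒰, x ∈ U := fun x => by
      simpa using (hcov ▸ mem_univ x : x ∈ ⋃₀ 𝒰)
    choose V hV hxV using h
    refine ⟨range V, range_subset_iff.2 hV, ?_, ?_⟩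
    · exact Cardinal.mk_range_le.trans (mk_point D).le
    · exact eq_univ_of_forall fun x => ⟨V x, mem_range_self x, hxV x⟩
  refine le_antisymm (csInf_le' hmem) (le_csInf ⟨_, hmem⟩ ?_)
  rintro μ ⟨-, hμ⟩
  -- The cover by initial segments has no subcover of size at most `lam`, by regularity of `λ⁺`.
  obtain ⟨𝒱, hsub, hcard, hcov⟩ := hμ
    (range fun ε : Initial (Order.succ lam) => {x : Point D | x.base < ε})
    (by rintro _ ⟨ε, rfl⟩; exact isOpen_base_lt ε) (by
      refine eq_univ_of_forall fun x => ?_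
      obtain ⟨ε, hε⟩ := Initial.exists_gt D.isRegular_succ x.base
      exact ⟨_, ⟨ε, rfl⟩, hε⟩)
  by_contra! hlt
  choose f hf using fun V : 𝒱 => hsub V.2
  obtain ⟨b, hb⟩ := Initial.exists_forall_lt_image D.isRegular_succ (univ : Set 𝒱)
    (by rw [Cardinal.mk_univ]; exact hcard.trans_lt hlt) f
  obtain ⟨p⟩ := Initial.nonempty D.isRegular
  obtain ⟨V, hV, hxV⟩ : (⟨b, p, 0⟩ : Point D) ∈ ⋃₀ 𝒱 := hcov ▸ mem_univ _
  have hxf : (⟨b, p, 0⟩ : Point D) ∈ {x : Point D | x.base < f ⟨V, hV⟩} :=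
    (hf ⟨V, hV⟩).ge hxV
  exact lt_asymm (hb ⟨V, hV⟩ (mem_univ _)) hxf

end LadderSystem

/-! ### Ladder systems from the club principle. -/

/-- The ordinal of an element of `Initial μ`. -/
noncomputable def Initial.toOrd {μ : Cardinal.{u}} (a : Initial μ) : Ordinal.{u} :=
  (Ordinal.ToType.mk.symm a : Iio μ.ord)

theorem Initial.toOrd_lt_ord {μ : Cardinal.{u}} (a : Initial μ) : a.toOrd < μ.ord :=
  (Ordinal.ToType.mk.symm a : Iio μ.ord).2

theorem Initial.toOrd_lt {μ : Cardinal.{u}} {a b : Initial μ} : a.toOrd < b.toOrd ↔ a < b :=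
  Subtype.coe_lt_coe.trans (OrderIso.lt_iff_lt _)

theorem Initial.toOrd_injective {μ : Cardinal.{u}} :
    Function.Injective (Initial.toOrd : Initial μ → Ordinal.{u}) :=
  Subtype.val_injective.comp (OrderIso.injective _)

theorem Initial.exists_toOrd_eq {μ : Cardinal.{u}} {o : Ordinal.{u}} (ho : o < μ.ord) :
    ∃ a : Initial μ, a.toOrd = o :=
  ⟨Ordinal.ToType.mk ⟨o, ho⟩, by simp [Initial.toOrd]⟩

theorem Initial.exists_bound_of_lt_cof {μ : Cardinal.{u}} (α : Initial μ) (S : Set (Initial μ))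
    (hS : ∀ s ∈ S, s < α) (hcard : #S < α.toOrd.cof) : ∃ γ < α, ∀ s ∈ S, s < γ := by
  have hlt : ⨆ s : S, s.1.toOrd + 1 < α.toOrd :=
    Ordinal.iSup_add_one_lt_of_lt_cof hcard fun s => Initial.toOrd_lt.2 (hS s s.2)
  obtain ⟨γ, hγ⟩ := Initial.exists_toOrd_eq (hlt.trans α.toOrd_lt_ord)
  refine ⟨γ, Initial.toOrd_lt.1 (hγ ▸ hlt), fun s hs => Initial.toOrd_lt.1 ?_⟩
  rw [hγ]
  exact (lt_add_one _).trans_le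
    (le_ciSup (f := fun s : S => s.1.toOrd + 1) Ordinal.bddAbove_of_small ⟨s, hs⟩)

theorem IsCofinalSubset.sSup_le {A : Set Ordinal.{u}} {α : Ordinal.{u}}
    (h : IsCofinalSubset A α) : sSup A ≤ α := csSup_le' fun _ ha => (h.1 ha).le

theorem IsCofinalSubset.eq {A : Set Ordinal.{u}} {α β : Ordinal.{u}} (h : IsCofinalSubset A α)
    (h' : IsCofinalSubset A β) : α = β := by
  refine le_antisymm (not_lt.1 fun hlt => ?_) (not_lt.1 fun hlt => ?_)
  · obtain ⟨γ, hγ, hle⟩ := h.2 β hlt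
    exact absurd (h'.1 hγ) (not_lt.2 hle)
  · obtain ⟨γ, hγ, hle⟩ := h'.2 α hlt
    exact absurd (h.1 hγ) (not_lt.2 hle)

theorem Initial.image_toOrd_mem_fullSubsets {μ : Cardinal.{u}} (hμ : μ.IsRegular)
    (Y : Set (Initial μ)) (hY : ∀ b, ∃ a ∈ Y, b ≤ a) : Initial.toOrd '' Y ∈ fullSubsets μ := by
  refine ⟨by rintro _ ⟨a, -, rfl⟩; exact a.toOrd_lt_ord, ?_⟩
  have hYμ : #Y = μ := by
    refine le_antisymm ((Cardinal.mk_set_le Y).trans (Initial.mk_eq μ).le) (not_lt.1 fun hlt => ?_)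
    obtain ⟨b, hb⟩ := Initial.exists_forall_lt hμ Y hlt
    obtain ⟨a, ha, hle⟩ := hY b
    exact absurd (hb a ha) (not_lt.2 hle)
  have h := Cardinal.mk_image_eq_of_injOn_lift Initial.toOrd Y Initial.toOrd_injective.injOn
  rw [hYμ, Cardinal.lift_id'.{u, u + 1}] at h
  exact h

theorem LadderSystem.nonempty_of_clubAD {lam : Cardinal.{u}} (hlam : lam.IsRegular)
    (h : ClubAD (Order.succ lam) {cofLevel (Order.succ lam) lam} lam 1) :
    Nonempty (LadderSystem lam) := by
  classical
  have h0 := hlam.aleph0_le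
  obtain ⟨𝒜, ⟨hlad, hAD⟩, hcard, hguess⟩ := h
  rw [sUnion_singleton] at hlad hAD hcard
  let E : Set (Initial (Order.succ lam)) := {a | a.toOrd.cof = lam}
  have hE : ∀ a ∈ E, a.toOrd ∈ cofLevel (Order.succ lam) lam :=
    fun a ha => ⟨a.toOrd_lt_ord, ha⟩
  have hlim : ∀ a ∈ E, Order.IsSuccLimit a.toOrd := fun a ha =>
    Ordinal.one_lt_cof_iff.1
      (Cardinal.one_lt_aleph0.trans_le (h0.trans (ha : a.toOrd.cof = lam).ge))
  have hemb : ∀ a : Initial (Order.succ lam), ∃ A : Initial lam → ℕ → Set Ordinal.{u}, a ∈ E →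
      (∀ p n, A p n ∈ 𝒜 a.toOrd) ∧ ∀ p n p' n', A p n = A p' n' → p = p' ∧ n = n' := by
    intro a
    by_cases ha : a ∈ E
    swap
    · exact ⟨fun _ _ => ∅, fun h => absurd h ha⟩
    -- Since `λ · ℵ₀ = λ`, the family at `a` has room for distinct ladders indexed by columns and
    -- levels.
    have hle : Cardinal.lift.{u + 1} #(Initial lam × ULift.{u} ℕ) ≤
        Cardinal.lift.{u} #(𝒜 a.toOrd) := by
      rw [hcard _ (hE a ha), Cardinal.lift_id'.{u, u + 1}]
      simp only [Cardinal.mk_prod, Cardinal.lift_id, Initial.mk_eq]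
      rw [Cardinal.mk_uLift, Cardinal.mk_nat, Cardinal.lift_aleph0, Cardinal.mul_aleph0_eq h0]
    obtain ⟨e⟩ := Cardinal.lift_mk_le'.1 hle
    refine ⟨fun p n => e (p, ⟨n⟩), fun _ => ⟨fun p n => (e _).2, fun p n p' n' h => ?_⟩⟩
    simpa using e.injective (Subtype.ext h)
  choose A hA using hemb
  have hcof : ∀ a ∈ E, ∀ p n, IsCofinalSubset (A a p n) a.toOrd := fun a ha p n =>
    (hlad _ (hE a ha) a.toOrd_lt_ord (hlim a ha)).2.1 _ ((hA a ha).1 p n)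
  obtain ⟨fn, hfn⟩ := Initial.exists_eventually_increasing hlam
  have hcode : #(Initial lam × Initial lam × Initial lam) ≤ #(Initial lam) := by
    simp only [Cardinal.mk_prod, Cardinal.lift_id, Initial.mk_eq]
    rw [Cardinal.mul_eq_self h0, Cardinal.mul_eq_self h0]
  obtain ⟨c⟩ := hcode
  refine ⟨{
    E := E
    ladder := fun α p n => {a | a.toOrd ∈ A α p n}
    fn := fn
    code := fun i k p => c (i, k, p)
    isRegular := hlam
    exists_bound := fun α hα S hS hcard => Initial.exists_bound_of_lt_cof α S hS
      (hcard.trans_eq (hα : α.toOrd.cof = lam).symm)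
    lt_of_mem_ladder := fun α hα p n a ha => Initial.toOrd_lt.1 ((hcof α hα p n).1 ha)
    ladder_inter := ?_
    guess := ?_
    fn_lt := hfn
    code_inj := fun i k p i' k' p' h => by simpa using h }⟩
  · intro α hα α' hα' p n p' n' hne
    have hAne : A α p n ≠ A α' p' n' := by
      intro heq
      -- A set is cofinal in only one ordinal, so ladders at different heights are different sets
      -- and almost disjointness applies.
      have hαα' : α = α' := Initial.toOrd_injective
        ((hcof α hα p n).eq (heq ▸ hcof α' hα' p' n'))
      subst hαα'
      obtain ⟨rfl, rfl⟩ := (hA α hα).2 _ _ _ _ heq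
      exact hne rfl
    have hlt : sSup (A α p n ∩ A α' p' n') < α.toOrd :=
      (hAD _ (mem_biUnion (hE α hα) ((hA α hα).1 p n)) _
        (mem_biUnion (hE α' hα') ((hA α' hα').1 p' n')) hAne).trans_le (hcof α hα p n).sSup_le
    have hlt' := (hlim α hα).succ_lt hlt
    obtain ⟨γ, hγ⟩ := Initial.exists_toOrd_eq (hlt'.trans α.toOrd_lt_ord)
    refine ⟨γ, Initial.toOrd_lt.1 (hγ ▸ hlt'), fun a ha ha' => Initial.toOrd_lt.1 ?_⟩
    rw [hγ, Order.lt_succ_iff]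
    exact le_csSup ⟨α.toOrd, fun b hb => ((hcof α hα p n).1 hb.1).le⟩ ⟨ha, ha'⟩
  · intro Y hY
    have hstat := hguess {Initial.toOrd '' Y} (singleton_subset_iff.2
      (Initial.image_toOrd_mem_fullSubsets (Cardinal.isRegular_succ h0) Y hY)) (by
        rw [Cardinal.mk_singleton, ← Cardinal.lift_one.{u, u + 1}, Cardinal.lift_lt]
        exact Order.lt_succ 1) _ (mem_singleton _)
    -- One guessing point suffices, so only nonemptiness of the stationary set is needed.
    obtain ⟨⟨o, ho⟩, hmem, hsup⟩ := hstat.2.nonempty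
    obtain ⟨α, rfl⟩ := Initial.exists_toOrd_eq ho
    have hα : α ∈ E := hmem.2
    refine ⟨α, hα, fun p n γ hγ => ?_⟩
    by_contra! hnot
    have hle : sSup (A α p n ∩ Initial.toOrd '' Y) ≤ γ.toOrd := by
      refine csSup_le' ?_
      rintro _ ⟨ha, a, haY, rfl⟩
      exact (Initial.toOrd_lt.2 (hnot a ha haY)).le
    rw [hsup _ ((hA α hα).1 p n) _ (mem_singleton _)] at hle
    exact absurd (Initial.toOrd_lt.2 hγ) (not_lt.2 hle)

theorem theoremD (lam : Cardinal.{u}) (hlam : lam.IsRegular)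
    (h : ClubAD (Order.succ lam) {cofLevel (Order.succ lam) lam} lam 1) :
    ∃ (X : Type u) (_ : TopologicalSpace X),
      IsCollectionwiseNormal X ∧ IsDowker X ∧ #X = Order.succ lam ∧
      hereditaryDensity X = lam ∧ lindelofDegree X = Order.succ lam := by
  obtain ⟨D⟩ := LadderSystem.nonempty_of_clubAD hlam h
  exact ⟨D.Point, inferInstance, D.isCollectionwiseNormal, D.isDowker, D.mk_point,
    D.hereditaryDensity_eq, D.lindelofDegree_eq⟩
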